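/- Let $N\in\mathbb N$ and, for $1\le i\le N$, let $X_i$ be a metric space, $S_i:X_i\to X_i$ a continuous map, $m_i$ an $S_i$-invariant ergodic Borel probability measure on $X_i$, and $U_i\subset X_i$ an open set which is the top level of a tower of height $n_i+1>N$ for $S_i$: there is a set $B_i\subset X_i$ such that the levels $S_i^k(B_i)$, $k=0,\dots,n_i$, are pairwise disjoint, $S_i^{n_i}(B_i)=U_i$, and $S_i^{-1}(S_i^{k+1}(B_i))=S_i^{k}(B_i)$ up to an $m_i$-null set for $0\le k<n_i$ (the last condition is automatic if $S_i$ is injective). Let $X=X_1\times\dots\times X_N$ and $m=m_1\otimes\dots\otimes m_N$. For $x\in X$ put $$A(x,1)=|\{i: x_i\in U_i\}|,\qquad A(x,k+1)=|\{i:\ \exists\, 0\le l\le A(x,k),\ S_i^l(x_i)\in U_i\}|\quad(k\ge 1),$$ and let the avalanche size $A(x)$ be the value $A(x,k)$ for the first $k$ with $A(x,k)=A(x,k+1)$. For $a\in\{0,\dots,N\}$ and $r\ge 0$ let $K_r(a)$ be the set of integer tuples $(k_1,\dots,k_{r+1})$ with $k_1,\dots,k_r\ge 1$, $\sum_{l=1}^r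 k_l=a$ and $k_{r+1}=N-a$, and put $k_0=1$. Then $A$ is measurable, and for every $a=0,1,\dots,N$ $$m(\{x\in X: A(x)=a\})=\sum_{r=0}^{a}\ \sum_{(k_1,\dots,k_{r+1})\in K_r(a)}\ \sum_{I_1,\dots,I_{r+1}}\ \prod_{l=1}^{r}\prod_{i\in I_l}k_{l-1}\,m_i(U_i)\ \prod_{i\in I_{r+1}}\bigl(1-(a+1)m_i(U_i)\bigr),$$ where the inner sum is over all ordered partitions of $\{1,\dots,N\}$ into sets $I_1,\dots,I_{r+1}$ of sizes $k_1,\dots,k_{r+1}$ (the set $I_{r+1}$ may be empty). Here $K_0(a)$ is empty unless $a=0$, so the term $r=0$ occurs only for $a=0$, where the right-hand side is $\prod_{i=1}^N(1-m_i(U_i))$. In particular, if $m_i(U_i)=p$ for all $i=1,\dots,N$, then for every $a=0,1,\dots,N$ $$m(\{x\in X: A(x)=a\})=(a+1)^{a-1}\binom Na p^a\bigl(1-(a+1)p\bigr)^{N-a}.$$ -/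

import Mathlib

open MeasureTheory

/-- `B` is the base and `U` the top level of a tower of height `n + 1` for the transformation `S`:
the levels `B, S(B), …, Sⁿ(B)` are pairwise disjoint, `Sⁿ(B) = U`, and, up to `μ`-null sets, the
points that `S` maps into a level above the base are exactly those of the level below it.
The last condition holds automatically (and without null sets) when `S` is injective. -/
structure IsTower {X : Type*} [MeasurableSpace X] (S : X → X) (μ : Measure X)
    (B : Set X) (n : ℕ) (U : Set X) : Prop where
  disjoint_levels : ∀ j ≤ n, ∀ k ≤ n, j ≠ k → Disjoint (S^[j] '' B) (S^[k] '' B)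
  top_level : S^[n] '' B = U
  preimage_level : ∀ k < n, S ⁻¹' (S^[k + 1] '' B) =ᵐ[μ] S^[k] '' B

section Avalanche

variable {N : ℕ} {X : Fin N → Type*}

/-- The number of coordinates of `x` that enter their set `U i` at some time `0 ≤ l ≤ c`. -/
noncomputable def numExcited (S : ∀ i, X i → X i) (U : ∀ i, Set (X i)) (x : ∀ i, X i) (c : ℕ) : ℕ :=
  Set.ncard {i : Fin N | ∃ l ≤ c, (S i)^[l] (x i) ∈ U i}

/-- The sequence `A(x, 1), A(x, 2), …`, indexed from `0`: `avalancheSeq S U x k` is `A(x, k + 1)`,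
where `A(x, 1) = |{i | x i ∈ U i}|` and
`A(x, k + 1) = |{i | ∃ 0 ≤ l ≤ A(x, k), (S i)^l (x i) ∈ U i}|`. -/
noncomputable def avalancheSeq (S : ∀ i, X i → X i) (U : ∀ i, Set (X i)) (x : ∀ i, X i) : ℕ → ℕ
  | 0 => Set.ncard {i : Fin N | x i ∈ U i}
  | k + 1 => numExcited S U x (avalancheSeq S U x k)

theorem numExcited_mono (S : ∀ i, X i → X i) (U : ∀ i, Set (X i)) (x : ∀ i, X i) :
    Monotone (numExcited S U x) := by
  intro c d h
  refine Set.ncard_le_ncard ?_ (Set.toFinite _)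
  rintro i ⟨l, hl, hi⟩
  exact ⟨l, hl.trans h, hi⟩

theorem avalancheSeq_le_succ (S : ∀ i, X i → X i) (U : ∀ i, Set (X i)) (x : ∀ i, X i) (k : ℕ) :
    avalancheSeq S U x k ≤ avalancheSeq S U x (k + 1) := by
  induction k with
  | zero =>
    refine Set.ncard_le_ncard ?_ (Set.toFinite _)
    intro i hi
    exact ⟨0, Nat.zero_le _, hi⟩
  | succ k ih => exact numExcited_mono S U x ih

theorem avalancheSeq_le (S : ∀ i, X i → X i) (U : ∀ i, Set (X i)) (x : ∀ i, X i) (k : ℕ) :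
    avalancheSeq S U x k ≤ N := by
  have key : ∀ s : Set (Fin N), s.ncard ≤ N := fun s => by
    simpa using Set.ncard_le_card s
  cases k with
  | zero => exact key _
  | succ k => exact key _

theorem exists_avalancheSeq_eq_succ (S : ∀ i, X i → X i) (U : ∀ i, Set (X i)) (x : ∀ i, X i) :
    ∃ k, avalancheSeq S U x k = avalancheSeq S U x (k + 1) := by
  by_contra! h
  have hs : StrictMono (avalancheSeq S U x) :=
    strictMono_nat_of_lt_succ fun k => lt_of_le_of_ne (avalancheSeq_le_succ S U x k) (h k)
  have h1 := hs.le_apply (x := N + 1)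
  have h2 := avalancheSeq_le S U x (N + 1)
  omega

open Classical in
/-- The avalanche size `A(x)`: the value `A(x, k)` for the (first) `k` with
`A(x, k) = A(x, k + 1)`. From that `k` on the sequence is constant. -/
noncomputable def avalancheSize (S : ∀ i, X i → X i) (U : ∀ i, Set (X i)) (x : ∀ i, X i) : ℕ :=
  avalancheSeq S U x (Nat.find (exists_avalancheSeq_eq_succ S U x))

end Avalanche

/-- The tuples `(k₁, …, k_{r+1})` with `k₁, …, k_r ≥ 1`, `k₁ + ⋯ + k_r = a` and `k_{r+1} = N - a`
(for `a ≤ N`; then all entries are at most `N`). The entry `k_l` is `k (l - 1)` here. -/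
def avalancheSizes (N r a : ℕ) : Finset (Fin (r + 1) → ℕ) :=
  (Fintype.piFinset fun _ => Finset.range (N + 1)).filter fun k =>
    (∀ l : Fin r, 1 ≤ k l.castSucc) ∧ k (Fin.last r) + a = N ∧ ∑ l : Fin r, k l.castSucc = a

/-- The ordered partitions `(I₁, …, I_{r+1})` of `{1, …, N}` into sets of sizes
`k₁, …, k_{r+1}`. -/
def orderedPartitions (N r : ℕ) (k : Fin (r + 1) → ℕ) : Finset (Fin (r + 1) → Finset (Fin N)) :=
  Finset.univ.filter fun I =>
    (∀ l, (I l).card = k l) ∧ (∀ l l', l ≠ l' → Disjoint (I l) (I l')) ∧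
      Finset.univ.biUnion I = Finset.univ

/-- The size `k_{l-1}` of the block before the `l`-th one, where `k₀ = 1`. -/
def prevSize {r : ℕ} (k : Fin (r + 1) → ℕ) (l : Fin r) : ℕ :=
  if l.val = 0 then 1 else k ⟨l.val - 1, by omega⟩

/-! Let `E_0 = ∅` and let `E_(l+1)` be the set of coordinates that enter their `U i` within time
`|E_l|`. These sets increase to a final set whose size is the avalanche size. If `r` is the first
stationary index, the increments `E_(l+1) \ E_l` for `l < r`, followed by the complement of `E_r`,
form an ordered partition of the coordinates. So the event that the size is `a` is a disjoint union,
over such partitions, of the sets of states producing them (`setOf_avalancheSize_eq`).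

Once the partition is fixed, so are all sizes `|E_l|`, and the event becomes a product set
(`mem_blockBox_iff`). By the tower hypothesis, `c + 1` successive preimages of `U` are almost
disjoint, so entering `U` within time `c` has probability `(c + 1) μ(U)`
(`IsTower.measureReal_hitBy`). A coordinate of a block lies in a difference of two such sets, whose
measure is the size of the preceding block times `μ(U)`; a coordinate of the last block contributes
`1 - (a + 1) μ(U)`.

For equal probabilities, what remains is the sum of the products of `k_(l-1) ^ k_l`. Each product
counts the ways to attach every point to one in the previous level, so the sum counts rooted
forests. `sum_blockWeight` evaluates it in Cayley's form by removing the first level, for an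
arbitrary number `s` of roots. -/

/-! ### Hitting probabilities of the top of a tower -/

section Tower

variable {X : Type*}

/-- The points that enter `U` at some time `0 ≤ l ≤ c` under iteration of `S`. -/
def hitBy (S : X → X) (U : Set X) (c : ℕ) : Set X :=
  {y | ∃ l ≤ c, S^[l] y ∈ U}

theorem hitBy_mono (S : X → X) (U : Set X) : Monotone (hitBy S U) :=
  fun _ _ h _ ⟨l, hl, hy⟩ => ⟨l, hl.trans h, hy⟩

theorem hitBy_eq_biUnion (S : X → X) (U : Set X) (c : ℕ) :
    hitBy S U c = ⋃ l ∈ Finset.range (c + 1), S^[l] ⁻¹' U := by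
  ext y
  simp [hitBy]

variable [MeasurableSpace X] {μ : Measure X} {S : X → X} {U B : Set X} {n : ℕ}

theorem measurableSet_hitBy (hS : Measurable S) (hU : MeasurableSet U) (c : ℕ) :
    MeasurableSet (hitBy S U c) := by
  rw [hitBy_eq_biUnion]
  exact Finset.measurableSet_biUnion _ fun l _ => hS.iterate l hU

/-- Pulling back by `S` descends one level of the tower, and invariance of `μ` keeps the accumulated
exceptional sets null. -/
theorem IsTower.preimage_top_ae_eq (h : IsTower S μ B n U) (hS : MeasurePreserving S μ μ) {l : ℕ}
    (hl : l ≤ n) : S^[l] ⁻¹' U =ᵐ[μ] S^[n - l] '' B := by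
  induction l with
  | zero => rw [Nat.sub_zero, h.top_level]; rfl
  | succ l ih =>
    have h1 : S ⁻¹' (S^[l] ⁻¹' U) =ᵐ[μ] S ⁻¹' (S^[n - l] '' B) :=
      hS.quasiMeasurePreserving.preimage_ae_eq (ih (by omega))
    have h2 := h.preimage_level (n - (l + 1)) (by omega)
    rw [show n - (l + 1) + 1 = n - l by omega] at h2
    rw [Function.iterate_succ, Set.preimage_comp]
    exact h1.trans h2

theorem IsTower.measureReal_hitBy [IsFiniteMeasure μ] (h : IsTower S μ B n U)
    (hS : MeasurePreserving S μ μ) (hU : MeasurableSet U) {c : ℕ} (hc : c ≤ n) :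
    μ.real (hitBy S U c) = ((c : ℝ) + 1) * μ.real U := by
  rw [hitBy_eq_biUnion, measureReal_biUnion_finset₀]
  · rw [Finset.sum_congr rfl (g := fun _ => μ.real U) fun l _ =>
      (hS.iterate l).measureReal_preimage hU.nullMeasurableSet]
    simp
  · intro j hj k hk hjk
    simp only [Finset.coe_range, Set.mem_Iio] at hj hk
    have hd := h.disjoint_levels (n - j) (by omega) (n - k) (by omega) (by omega)
    exact hd.aedisjoint.congr (h.preimage_top_ae_eq hS (by omega))
      (h.preimage_top_ae_eq hS (by omega))
  · exact fun l _ => (hS.measurable.iterate l hU).nullMeasurableSet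

end Tower

/-! ### Ordered block splittings and the count of rooted forests -/

section Blocks

variable {α : Type*}

/-- The size of the block before the `l`-th one, with the value `s` for the first block. -/
def prevSizeFrom {r : ℕ} (s : ℕ) (k : Fin (r + 1) → ℕ) (l : Fin r) : ℕ :=
  if l.val = 0 then s else k ⟨l.val - 1, by omega⟩

theorem prevSizeFrom_one {r : ℕ} (k : Fin (r + 1) → ℕ) (l : Fin r) :
    prevSizeFrom 1 k l = prevSize k l := rfl

theorem prevSizeFrom_cons_succ {r : ℕ} (s : ℕ) (K : Finset α) (I : Fin (r + 1) → Finset α)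
    (l : Fin r) :
    prevSizeFrom s (fun j => ((Fin.cons K I : Fin (r + 2) → Finset α) j).card) l.succ =
      prevSizeFrom K.card (fun j => (I j).card) l := by
  obtain ⟨l, hl⟩ := l
  cases l with
  | zero => rfl
  | succ l => rfl

variable [DecidableEq α]

/-- `I` splits `J` into `r` nonempty blocks followed by a last block of size `b`. -/
def IsBlocks (r : ℕ) (J : Finset α) (b : ℕ) (I : Fin (r + 1) → Finset α) : Prop :=
  (∀ l : Fin r, (I l.castSucc).Nonempty) ∧ (∀ l l', l ≠ l' → Disjoint (I l) (I l')) ∧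
    Finset.univ.biUnion I = J ∧ (I (Fin.last r)).card = b

open Classical in
/-- The sum, over all `r`-block splittings of `J`, of the number of ways to map every block but the
last one to the block before it. -/
noncomputable def blockWeight [Fintype α] (r s : ℕ) (J : Finset α) (b : ℕ) : ℕ :=
  ∑ I : Fin (r + 1) → Finset α, if IsBlocks r J b I then
    ∏ l : Fin r, prevSizeFrom s (fun j => (I j).card) l ^ (I l.castSucc).card else 0

theorem isBlocks_zero (J : Finset α) (b : ℕ) (I : Fin 1 → Finset α) :
    IsBlocks 0 J b I ↔ I 0 = J ∧ (I 0).card = b := by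
  simp only [IsBlocks, IsEmpty.forall_iff, true_and, Fin.last_zero]
  constructor
  · rintro ⟨-, h, h'⟩
    exact ⟨by simpa using h, h'⟩
  · rintro ⟨h, h'⟩
    refine ⟨fun l l' hl => absurd (Subsingleton.elim (α := Fin 1) l l') hl, by simpa using h, h'⟩

/-- Removing the first block is the recursion behind `blockWeight_succ`; its size then becomes the
starting value `s` for the remaining blocks. -/
theorem isBlocks_cons {r : ℕ} (J : Finset α) (b : ℕ) (K : Finset α) (I : Fin (r + 1) → Finset α) :
    IsBlocks (r + 1) J b (Fin.cons K I : Fin (r + 2) → Finset α) ↔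
      (K.Nonempty ∧ K ⊆ J) ∧ IsBlocks r (J \ K) b I := by
  constructor
  · rintro ⟨h1, h2, h3, h4⟩
    have hd : ∀ l, Disjoint K (I l) := fun l => by
      simpa using h2 0 l.succ (Fin.succ_ne_zero l).symm
    have hK : K ⊆ J := by
      rw [← h3]
      change (Fin.cons K I : Fin (r + 2) → Finset α) 0 ⊆ _
      exact Finset.subset_biUnion_of_mem (Fin.cons K I : Fin (r + 2) → Finset α)
        (Finset.mem_univ 0)
    refine ⟨⟨by simpa using h1 0, hK⟩, fun l => by simpa using h1 l.succ, fun l l' hl => ?_, ?_, ?_⟩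
    · simpa using h2 l.succ l'.succ (by simpa using hl)
    · ext i
      rw [← h3]
      simp only [Finset.mem_biUnion, Finset.mem_univ, true_and, Finset.mem_sdiff,
        Fin.exists_fin_succ (n := r + 1), Fin.cons_zero, Fin.cons_succ]
      constructor
      · rintro ⟨l, hl⟩
        exact ⟨Or.inr ⟨l, hl⟩, fun hi => Finset.disjoint_left.1 (hd l) hi hl⟩
      · rintro ⟨h | h, h'⟩
        · exact absurd h h'
        · exact h
    · simpa [← Fin.succ_last] using h4
  · rintro ⟨⟨hK, hJ⟩, h1, h2, h3, h4⟩
    have hd : ∀ l, Disjoint K (I l) := fun l => by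
      have : I l ⊆ J \ K := by
        rw [← h3]
        exact Finset.subset_biUnion_of_mem I (Finset.mem_univ l)
      exact (Finset.disjoint_of_subset_left this Finset.sdiff_disjoint).symm
    refine ⟨fun l => ?_, fun l l' hl => ?_, ?_, ?_⟩
    · cases l using Fin.cases with
      | zero => simpa using hK
      | succ l => simpa using h1 l
    · cases l using Fin.cases with
      | zero =>
        cases l' using Fin.cases with
        | zero => exact absurd rfl hl
        | succ l' => simpa using hd l'
      | succ l =>
        cases l' using Fin.cases with
        | zero => simpa using (hd l).symm
        | succ l' => simpa using h2 l l' (by simpa using hl)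
    · ext i
      have := congrArg (i ∈ ·) h3
      simp only [Finset.mem_biUnion, Finset.mem_univ, true_and, Finset.mem_sdiff, eq_iff_iff] at this
      simp only [Finset.mem_biUnion, Finset.mem_univ, true_and,
        Fin.exists_fin_succ (n := r + 1), Fin.cons_zero, Fin.cons_succ, this]
      have := @hJ i
      tauto
    · simpa [← Fin.succ_last] using h4

variable [Fintype α]

theorem blockWeight_zero (s : ℕ) (J : Finset α) (b : ℕ) :
    blockWeight 0 s J b = if J.card = b then 1 else 0 := by
  classical
  unfold blockWeight
  rw [Fintype.sum_eq_single (fun _ => J)]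
  · simp [isBlocks_zero]
  · intro I hI
    rw [if_neg]
    rw [isBlocks_zero]
    rintro ⟨h, -⟩
    exact hI (funext fun l => by rw [Subsingleton.elim (α := Fin 1) l 0]; exact h)

theorem blockWeight_succ (r s : ℕ) (J : Finset α) (b : ℕ) :
    blockWeight (r + 1) s J b =
      ∑ K ∈ J.powerset with K.Nonempty, s ^ K.card * blockWeight r K.card (J \ K) b := by
  classical
  have hK : J.powerset.filter (·.Nonempty) = Finset.univ.filter fun K => K.Nonempty ∧ K ⊆ J := by
    ext K
    simp [and_comm]
  rw [hK, Finset.sum_filter]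
  unfold blockWeight
  rw [← (Fin.consEquiv fun _ : Fin (r + 2) => Finset α).sum_comp, Fintype.sum_prod_type]
  refine Finset.sum_congr rfl fun K _ => ?_
  refine (Finset.sum_congr rfl fun I _ => if_congr (isBlocks_cons J b K I) rfl rfl).trans ?_
  by_cases h : K.Nonempty ∧ K ⊆ J
  · rw [if_pos h, Finset.mul_sum]
    refine Finset.sum_congr rfl fun I _ => ?_
    by_cases hI : IsBlocks r (J \ K) b I
    · rw [if_pos ⟨h, hI⟩, if_pos hI, Fin.prod_univ_succ]
      refine congrArg₂ _ rfl (Finset.prod_congr rfl fun l _ => ?_)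
      exact congrArg₂ _ (prevSizeFrom_cons_succ s K I l) rfl
    · rw [if_neg fun h' => hI h'.2, if_neg hI, mul_zero]
  · rw [if_neg h]
    exact Finset.sum_eq_zero fun I _ => if_neg fun h' => h h'.1

theorem blockWeight_eq_zero {r s : ℕ} {J : Finset α} {b : ℕ} (h : J.card < b) :
    blockWeight r s J b = 0 := by
  classical
  refine Finset.sum_eq_zero fun I _ => if_neg ?_
  rintro ⟨-, -, h3, h4⟩
  have := Finset.card_le_card
    (Finset.subset_biUnion_of_mem I (Finset.mem_univ (Fin.last r)))
  rw [h3] at this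
  omega

/-- The number of functions from an `a`-element set to its disjoint union with an `s`-element set
under which every point eventually reaches the latter. -/
def rootedForests (s : ℕ) : ℕ → ℕ
  | 0 => 1
  | a + 1 => s * (s + (a + 1)) ^ a

/-- Division-free form of the count `s (s + j) ^ (j - 1)` with `s = k + 1`, covering `j = 0` as
well. -/
theorem rootedForests_self_add (k j : ℕ) : (k + 1) * (k + 1 + j) ^ j =
    rootedForests (k + 1) j * (k + 1 + j) := by
  cases j with
  | zero => simp [rootedForests]
  | succ j => simp only [rootedForests]; ring

/-- Decomposition of a rooted forest by the set of the points that are mapped to a root. -/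
theorem sum_choose_mul_rootedForests (s a : ℕ) :
    ∑ k ∈ Finset.range (a + 1),
        (a + 1).choose (k + 1) * (s ^ (k + 1) * rootedForests (k + 1) (a - k)) =
      rootedForests s (a + 1) := by
  have h : ∀ k ∈ Finset.range (a + 1),
      (a + 1).choose (k + 1) * (s ^ (k + 1) * rootedForests (k + 1) (a - k)) =
        s * (s ^ k * (a + 1) ^ (a - k) * a.choose k) := by
    intro k hk
    have hk' : k ≤ a := by simpa [Nat.lt_succ_iff] using hk
    have h1 := rootedForests_self_add k (a - k)
    rw [show k + 1 + (a - k) = a + 1 by omega] at h1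
    have h2 := Nat.add_one_mul_choose_eq a k
    -- The factor `a + 1` is both the base in the forest count and the numerator in the absorption
    -- identity for binomials; after cancelling it the sum is the expansion of `(s + (a + 1)) ^ a`.
    refine Nat.eq_of_mul_eq_mul_right (Nat.succ_pos a) ?_
    calc (a + 1).choose (k + 1) * (s ^ (k + 1) * rootedForests (k + 1) (a - k)) * (a + 1)
        = (a + 1).choose (k + 1) * s ^ (k + 1) * (rootedForests (k + 1) (a - k) * (a + 1)) := by ring
      _ = s ^ (k + 1) * (a + 1) ^ (a - k) * ((a + 1).choose (k + 1) * (k + 1)) := by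
          rw [← h1]; ring
      _ = _ := by rw [← h2, Nat.succ_eq_add_one]; ring
  rw [Finset.sum_congr rfl h, ← Finset.mul_sum]
  have h' := add_pow s (a + 1) a
  simp only [Nat.cast_id] at h'
  rw [← h']
  rfl

/-- The binomial chooses the non-final points and the other factor counts forests on them. The bound
`R` is separate from `a` because removing a first block lowers `a` by the block's size but the
number of blocks only by one. -/
theorem sum_blockWeight (a b R s : ℕ) (hR : a ≤ R) (J : Finset α) (hJ : J.card = a + b) :
    ∑ r ∈ Finset.range (R + 1), blockWeight r s J b = (a + b).choose a * rootedForests s a := by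
  induction R generalizing a s J with
  | zero =>
    obtain rfl : a = 0 := by omega
    simp [blockWeight_zero, hJ, rootedForests]
  | succ R ih =>
    rw [Finset.sum_range_succ', blockWeight_zero]
    simp only [blockWeight_succ]
    rw [Finset.sum_comm]
    simp only [← Finset.mul_sum]
    cases a with
    | zero =>
      rw [Finset.sum_eq_zero]
      · simp [hJ, rootedForests]
      · intro K hK
        simp only [Finset.mem_filter, Finset.mem_powerset] at hK
        rw [Finset.sum_eq_zero, mul_zero]
        intro r _
        apply blockWeight_eq_zero
        rw [Finset.card_sdiff_of_subset hK.1]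
        have := Finset.card_le_card hK.1
        have := hK.2.card_pos
        omega
    | succ a =>
      rw [if_neg (by omega), add_zero]
      have hsum : ∀ K ∈ J.powerset.filter (·.Nonempty),
          s ^ K.card * ∑ r ∈ Finset.range (R + 1), blockWeight r K.card (J \ K) b =
          s ^ K.card * (if K.card ≤ a + 1 then (a + 1 + b - K.card).choose b *
            rootedForests K.card (a + 1 - K.card) else 0) := by
        intro K hK
        simp only [Finset.mem_filter, Finset.mem_powerset] at hK
        have h1 := hK.2.card_pos
        have h2 := Finset.card_le_card hK.1
        have h3 := Finset.card_sdiff_of_subset hK.1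
        congr 1
        split_ifs with h
        · rw [ih (a + 1 - K.card) K.card (by omega) (J \ K) (by omega),
            show a + 1 - K.card + b = a + 1 + b - K.card by omega,
            ← Nat.choose_symm (show b ≤ a + 1 + b - K.card by omega),
            show a + 1 + b - K.card - b = a + 1 - K.card by omega]
        · exact Finset.sum_eq_zero fun r _ => blockWeight_eq_zero (by omega)
      rw [Finset.sum_congr rfl hsum, Finset.sum_filter]
      -- The summand depends on `K` only through its size, so the sum over subsets becomes a
      -- binomial sum over sizes.
      have hs2 : ∀ K ∈ J.powerset, (if K.Nonempty then s ^ K.card * (if K.card ≤ a + 1 then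
            (a + 1 + b - K.card).choose b * rootedForests K.card (a + 1 - K.card) else 0) else 0) =
          (fun k => if 0 < k then s ^ k * (if k ≤ a + 1 then
            (a + 1 + b - k).choose b * rootedForests k (a + 1 - k) else 0) else 0) K.card := by
        intro K _
        simp only [Finset.card_pos]
      rw [Finset.sum_congr rfl hs2, Finset.sum_powerset_apply_card (f := fun k => if 0 < k then s ^ k * (if k ≤ a + 1 then
          (a + 1 + b - k).choose b * rootedForests k (a + 1 - k) else 0) else 0), hJ,
        ← sum_choose_mul_rootedForests, Finset.mul_sum, Finset.sum_range_succ',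
        ← Finset.sum_subset (s₁ := Finset.range (a + 1))]
      · simp only [lt_self_iff_false, if_false, smul_zero, add_zero]
        refine Finset.sum_congr rfl fun k hk => ?_
        have hk' : k ≤ a := by simpa [Nat.lt_succ_iff] using hk
        rw [if_pos (Nat.succ_pos k), if_pos (by omega), smul_eq_mul,
          show a + 1 - (k + 1) = a - k by omega]
        -- Choosing the first block and then the other forest points amounts to choosing all forest
        -- points and then the first block among them.
        have h1 := Nat.choose_mul (n := a + 1 + b) (k := a + 1) (s := k + 1) (by omega)
        rw [← Nat.choose_symm (show b ≤ a + 1 + b - (k + 1) by omega),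
          show a + 1 + b - (k + 1) - b = a + 1 - (k + 1) by omega]
        calc _ = ((a + 1 + b).choose (k + 1) * (a + 1 + b - (k + 1)).choose (a + 1 - (k + 1))) *
              (s ^ (k + 1) * rootedForests (k + 1) (a - k)) := by ring
          _ = _ := by rw [← h1]; ring
      · intro k hk
        simp at hk ⊢
        omega
      · intro k _ hk
        have hk' : a < k := by simpa [Nat.lt_succ_iff] using hk
        rw [if_pos (Nat.succ_pos k), if_neg (by omega), mul_zero, smul_zero]

end Blocks

theorem IsBlocks.eq_of_mem {α : Type*} [DecidableEq α] {r b : ℕ} {J : Finset α}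
    {I : Fin (r + 1) → Finset α} (hI : IsBlocks r J b I) {i : α} {j j' : Fin (r + 1)}
    (h : i ∈ I j) (h' : i ∈ I j') : j = j' := by
  by_contra hne
  exact Finset.disjoint_left.1 (hI.2.1 j j' hne) h h'

/-! ### Stages of an avalanche and the boxes they determine -/

section Stages

variable {N : ℕ} {X : Fin N → Type*} (S : ∀ i, X i → X i) (U : ∀ i, Set (X i))

open Classical in
/-- The set of the coordinates of `x` that are excited after `l` steps of the avalanche. -/
noncomputable def stage (x : ∀ i, X i) : ℕ → Finset (Fin N)
  | 0 => ∅
  | l + 1 => Finset.univ.filter fun i => x i ∈ hitBy (S i) (U i) (stage x l).card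

variable {S U}

theorem mem_stage_succ {x : ∀ i, X i} {l : ℕ} {i : Fin N} :
    i ∈ stage S U x (l + 1) ↔ x i ∈ hitBy (S i) (U i) (stage S U x l).card := by
  simp [stage]

/-- The shift comes from starting at `∅`: stage `1` then allows only time `0`, which is the initial
count. -/
theorem avalancheSeq_eq_card_stage (x : ∀ i, X i) (k : ℕ) :
    avalancheSeq S U x k = (stage S U x (k + 1)).card := by
  induction k with
  | zero =>
    rw [avalancheSeq, ← Set.ncard_coe_finset]
    congr 1
    ext i
    change x i ∈ U i ↔ i ∈ stage S U x (0 + 1)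
    rw [mem_stage_succ]
    refine ⟨fun h => ⟨0, Nat.zero_le _, h⟩, ?_⟩
    rintro ⟨l, hl, h⟩
    obtain rfl : l = 0 := by simpa [stage] using hl
    exact h
  | succ k ih =>
    rw [avalancheSeq, ih, numExcited, ← Set.ncard_coe_finset (stage S U x (k + 1 + 1))]
    congr 1
    ext i
    simp [mem_stage_succ, hitBy]

theorem monotone_stage (x : ∀ i, X i) : Monotone (stage S U x) := by
  refine monotone_nat_of_le_succ fun l => ?_
  induction l with
  | zero => exact Finset.empty_subset _
  | succ l ih =>
    intro i hi
    rw [mem_stage_succ] at hi ⊢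
    exact hitBy_mono _ _ (Finset.card_le_card ih) hi

theorem stage_eq_of_le {x : ∀ i, X i} {r : ℕ} (h : stage S U x r = stage S U x (r + 1)) {l : ℕ}
    (hl : r ≤ l) : stage S U x l = stage S U x r := by
  induction l, hl using Nat.le_induction with
  | base => rfl
  | succ l _ ih =>
    rw [h]
    ext i
    rw [mem_stage_succ, mem_stage_succ, ih]

theorem exists_stage_eq_succ (x : ∀ i, X i) : ∃ r, stage S U x r = stage S U x (r + 1) := by
  obtain ⟨k, hk⟩ := exists_avalancheSeq_eq_succ S U x
  rw [avalancheSeq_eq_card_stage, avalancheSeq_eq_card_stage] at hk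
  exact ⟨k + 1, Finset.eq_of_subset_of_card_le (monotone_stage x (Nat.le_succ _)) hk.ge⟩

theorem avalancheSize_eq_card_stage {x : ∀ i, X i} {r : ℕ}
    (h : stage S U x r = stage S U x (r + 1)) : avalancheSize S U x = (stage S U x r).card := by
  classical
  have hk := Nat.find_spec (exists_avalancheSeq_eq_succ S U x)
  unfold avalancheSize
  rw [avalancheSeq_eq_card_stage, avalancheSeq_eq_card_stage] at hk
  rw [avalancheSeq_eq_card_stage]
  have hk' := Finset.eq_of_subset_of_card_le (monotone_stage x (Nat.le_succ _)) hk.ge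
  rcases le_total r (Nat.find (exists_avalancheSeq_eq_succ S U x) + 1) with hr | hr
  · rw [stage_eq_of_le h hr]
  · rw [stage_eq_of_le hk' hr]

theorem avalancheSize_le (x : ∀ i, X i) : avalancheSize S U x ≤ N :=
  avalancheSeq_le S U x _

variable {r : ℕ}

open Classical in
/-- The union of the first `l` blocks of `I`, the last one excluded. -/
noncomputable def blocksUpto (I : Fin (r + 1) → Finset (Fin N)) (l : ℕ) : Finset (Fin N) :=
  Finset.univ.filter fun i => ∃ j : Fin (r + 1), (j.val < l ∧ j.val < r) ∧ i ∈ I j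

theorem mem_blocksUpto {I : Fin (r + 1) → Finset (Fin N)} {b : ℕ}
    (hI : IsBlocks r Finset.univ b I) {i : Fin N} {j : Fin (r + 1)} (hi : i ∈ I j) {l : ℕ} :
    i ∈ blocksUpto I l ↔ j.val < l ∧ j.val < r := by
  simp only [blocksUpto, Finset.mem_filter, Finset.mem_univ, true_and]
  refine ⟨?_, fun h => ⟨j, h, hi⟩⟩
  rintro ⟨j', h, hi'⟩
  rwa [hI.eq_of_mem hi hi']

theorem exists_mem_block {I : Fin (r + 1) → Finset (Fin N)} {b : ℕ}
    (hI : IsBlocks r Finset.univ b I) (i : Fin N) : ∃ j, i ∈ I j := by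
  have := Finset.mem_univ i
  rw [← hI.2.2.1] at this
  simpa using this

theorem blocksUpto_zero (I : Fin (r + 1) → Finset (Fin N)) : blocksUpto I 0 = ∅ := by
  simp [blocksUpto]

theorem monotone_blocksUpto (I : Fin (r + 1) → Finset (Fin N)) : Monotone (blocksUpto I) := by
  intro l l' h i
  simp only [blocksUpto, Finset.mem_filter, Finset.mem_univ, true_and]
  rintro ⟨j, ⟨h1, h2⟩, h3⟩
  exact ⟨j, ⟨h1.trans_le h, h2⟩, h3⟩

theorem card_blocksUpto_succ {I : Fin (r + 1) → Finset (Fin N)} {b : ℕ}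
    (hI : IsBlocks r Finset.univ b I) {l : ℕ} (hl : l < r) :
    (blocksUpto I (l + 1)).card = (blocksUpto I l).card + (I ⟨l, by omega⟩).card := by
  rw [← Finset.card_union_of_disjoint]
  · congr 1
    ext i
    obtain ⟨j, hj⟩ := exists_mem_block hI i
    rw [Finset.mem_union, mem_blocksUpto hI hj, mem_blocksUpto hI hj]
    have : i ∈ I ⟨l, by omega⟩ ↔ j.val = l :=
      ⟨fun h => by rw [hI.eq_of_mem hj h], fun h => by convert! hj; exact h.symm⟩
    rw [this]
    omega
  · rw [Finset.disjoint_left]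
    intro i hi hi'
    exact absurd ((mem_blocksUpto hI hi').1 hi).1 (lt_irrefl _)

theorem card_blocksUpto_last {I : Fin (r + 1) → Finset (Fin N)} {b : ℕ}
    (hI : IsBlocks r Finset.univ b I) : (blocksUpto I r).card + b = N := by
  have h : blocksUpto I r = (I (Fin.last r))ᶜ := by
    ext i
    obtain ⟨j, hj⟩ := exists_mem_block hI i
    rw [mem_blocksUpto hI hj, Finset.mem_compl, and_self]
    constructor
    · intro h h'
      rw [hI.eq_of_mem hj h'] at h
      exact absurd h (lt_irrefl _)
    · intro h
      by_contra h'
      have : j = Fin.last r := Fin.ext (by have := j.isLt; simp; omega)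
      exact h (this ▸ hj)
  rw [h, Finset.card_compl, Fintype.card_fin, ← hI.2.2.2]
  have := Finset.card_le_univ (I (Fin.last r))
  rw [Fintype.card_fin] at this
  omega

variable (S U)

/-- The values of the `i`-th coordinate for which it is excited exactly in the `j`-th step of an
avalanche with the blocks `I`, or not at all if `j = r`. -/
def blockCell (I : Fin (r + 1) → Finset (Fin N)) (j : Fin (r + 1)) (i : Fin N) : Set (X i) :=
  {y | ∀ l ≤ r, y ∈ hitBy (S i) (U i) (blocksUpto I l).card ↔ j.val ≤ l ∧ j.val < r}

/-- The states whose avalanche excites the blocks of `I`, except the last one, in this order. -/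
def blockBox (I : Fin (r + 1) → Finset (Fin N)) : Set (∀ i, X i) :=
  Set.univ.pi fun i => {y | ∀ j, i ∈ I j → y ∈ blockCell S U I j i}

variable {S U}

/-- By induction on the stage, the coordinatewise conditions with prescribed thresholds reproduce
the actual stages. The range reaches `r + 1`, where `blocksUpto` no longer grows, so stationarity is
included. -/
theorem mem_blockBox_iff {I : Fin (r + 1) → Finset (Fin N)} {b : ℕ}
    (hI : IsBlocks r Finset.univ b I) {x : ∀ i, X i} :
    x ∈ blockBox S U I ↔ ∀ l ≤ r + 1, stage S U x l = blocksUpto I l := by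
  constructor
  · intro hx l
    induction l with
    | zero => exact fun _ => (blocksUpto_zero I).symm
    | succ l ih =>
      intro hl
      ext i
      obtain ⟨j, hj⟩ := exists_mem_block hI i
      rw [mem_stage_succ, ih (by omega), mem_blocksUpto hI hj, hx i trivial j hj l (by omega),
        Nat.lt_succ_iff]
  · intro h i _ j hj l hl
    rw [← h l (by omega), ← mem_stage_succ, h (l + 1) (by omega), mem_blocksUpto hI hj,
      Nat.lt_succ_iff]

theorem blocksUpto_succ_ne {I : Fin (r + 1) → Finset (Fin N)} {b : ℕ}
    (hI : IsBlocks r Finset.univ b I) {l : ℕ} (hl : l < r) :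
    blocksUpto I l ≠ blocksUpto I (l + 1) := by
  intro h
  have h1 := card_blocksUpto_succ hI hl
  have h2 := (hI.1 ⟨l, hl⟩).card_pos
  simp only [Fin.castSucc_mk] at h2
  rw [← h] at h1
  omega

theorem stage_eq_succ_of_mem_blockBox {I : Fin (r + 1) → Finset (Fin N)} {b : ℕ}
    (hI : IsBlocks r Finset.univ b I) {x : ∀ i, X i} (hx : x ∈ blockBox S U I) :
    stage S U x r = stage S U x (r + 1) := by
  rw [mem_blockBox_iff hI] at hx
  rw [hx r (by omega), hx (r + 1) le_rfl]
  ext i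
  obtain ⟨j, hj⟩ := exists_mem_block hI i
  rw [mem_blocksUpto hI hj, mem_blocksUpto hI hj]
  omega

theorem avalancheSize_add_of_mem_blockBox {I : Fin (r + 1) → Finset (Fin N)} {b : ℕ}
    (hI : IsBlocks r Finset.univ b I) {x : ∀ i, X i} (hx : x ∈ blockBox S U I) :
    avalancheSize S U x + b = N := by
  rw [avalancheSize_eq_card_stage (stage_eq_succ_of_mem_blockBox hI hx),
    (mem_blockBox_iff hI).1 hx r (by omega), card_blocksUpto_last hI]

/-- The avalanche is stationary at `r'` by `I'`, but still growing at every index below `r` by `I`.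
-/
theorem le_of_mem_blockBox {r' : ℕ} {I : Fin (r + 1) → Finset (Fin N)}
    {I' : Fin (r' + 1) → Finset (Fin N)} {b b' : ℕ} (hI : IsBlocks r Finset.univ b I)
    (hI' : IsBlocks r' Finset.univ b' I') {x : ∀ i, X i} (hx : x ∈ blockBox S U I)
    (hx' : x ∈ blockBox S U I') : r ≤ r' := by
  by_contra! h
  have h1 := stage_eq_succ_of_mem_blockBox hI' hx'
  rw [mem_blockBox_iff hI] at hx
  rw [hx r' (by omega), hx (r' + 1) (by omega)] at h1
  exact blocksUpto_succ_ne hI h h1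

theorem eq_of_mem_blockBox {I I' : Fin (r + 1) → Finset (Fin N)} {b b' : ℕ}
    (hI : IsBlocks r Finset.univ b I) (hI' : IsBlocks r Finset.univ b' I') {x : ∀ i, X i}
    (hx : x ∈ blockBox S U I) (hx' : x ∈ blockBox S U I') : I = I' := by
  have key : ∀ i j j', i ∈ I j → i ∈ I' j' → j = j' := by
    intro i j j' hj hj'
    rw [mem_blockBox_iff hI] at hx
    rw [mem_blockBox_iff hI'] at hx'
    have h : ∀ l ≤ r + 1, (j.val < l ∧ j.val < r) ↔ (j'.val < l ∧ j'.val < r) := fun l hl => by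
      rw [← mem_blocksUpto hI hj, ← mem_blocksUpto hI' hj', ← hx l hl, ← hx' l hl]
    have h1 := h j (by omega)
    have h2 := h (j + 1) (by omega)
    have h3 := h (r + 1) le_rfl
    ext
    omega
  funext j
  ext i
  obtain ⟨k, hk⟩ := exists_mem_block hI i
  obtain ⟨k', hk'⟩ := exists_mem_block hI' i
  obtain rfl := key i k k' hk hk'
  constructor
  · intro h
    rwa [hI.eq_of_mem h hk]
  · intro h
    rwa [hI'.eq_of_mem h hk']

theorem exists_mem_blockBox (x : ∀ i, X i) :
    ∃ r ≤ avalancheSize S U x, ∃ I : Fin (r + 1) → Finset (Fin N),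
      IsBlocks r Finset.univ (N - avalancheSize S U x) I ∧ x ∈ blockBox S U I := by
  classical
  have hex := exists_stage_eq_succ (S := S) (U := U) x
  set r := Nat.find hex with hr
  have hrfix : stage S U x r = stage S U x (r + 1) := Nat.find_spec hex
  have hlt : ∀ l < r, stage S U x l ⊂ stage S U x (l + 1) := fun l hl =>
    (monotone_stage x (Nat.le_succ l)).lt_of_ne (Nat.find_min hex hl)
  -- Strict growth before the first stationary index bounds the number of blocks by the avalanche
  -- size.
  have hle : ∀ l ≤ r, l ≤ (stage S U x l).card := by
    intro l
    induction l with
    | zero => simp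
    | succ l ih =>
      intro hl
      have := Finset.card_lt_card (hlt l (by omega))
      have := ih (by omega)
      omega
  have hA := avalancheSize_eq_card_stage hrfix
  let I : Fin (r + 1) → Finset (Fin N) := fun j =>
    if j.val < r then stage S U x (j + 1) \ stage S U x j else (stage S U x r)ᶜ
  have hmem : ∀ i j, i ∈ I j → ∀ l ≤ r, i ∈ stage S U x l ↔ j.val < l ∧ j.val < r := by
    intro i j hi l hl
    simp only [I] at hi
    split_ifs at hi with hj
    · rw [Finset.mem_sdiff] at hi
      refine ⟨fun h => ⟨?_, hj⟩, fun h => monotone_stage x h.1 hi.1⟩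
      by_contra! hlj
      exact hi.2 (monotone_stage x hlj h)
    · rw [Finset.mem_compl] at hi
      exact ⟨fun h => absurd (monotone_stage x hl h) hi, fun h => absurd h.2 hj⟩
  have hI : IsBlocks r Finset.univ (N - avalancheSize S U x) I := by
    refine ⟨fun l => ?_, fun l l' hl => ?_, ?_, ?_⟩
    · simp only [I, Fin.val_castSucc, l.isLt, if_true]
      exact Finset.sdiff_nonempty.2 (hlt l l.isLt).2
    · rw [Finset.disjoint_left]
      intro i hi hi'
      have h1 := (hmem i l hi (l + 1))
      have h2 := (hmem i l hi l)
      have h1' := (hmem i l' hi' (l + 1))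
      have h2' := (hmem i l' hi' l)
      have h3 := (hmem i l hi (l' + 1))
      have h3' := (hmem i l' hi' (l' + 1))
      apply hl
      ext
      by_cases hlr : l.val < r <;> by_cases hlr' : l'.val < r
      · have := (h1' (by omega)).1 ((h1 (by omega)).2 (by omega))
        have := (h3 (by omega)).1 ((h3' (by omega)).2 (by omega))
        omega
      · have := (h1' (by omega)).1 ((h1 (by omega)).2 (by omega))
        omega
      · have := (h3 (by omega)).1 ((h3' (by omega)).2 (by omega))
        omega
      · omega
    · rw [Finset.eq_univ_iff_forall]
      intro i
      rw [Finset.mem_biUnion]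
      by_cases hi : i ∈ stage S U x r
      -- The block of `i` has index one less than the first stage containing `i`; that stage is not
      -- `0`, since stage `0` is empty.
      · have hex' : ∃ l, i ∈ stage S U x l := ⟨r, hi⟩
        have h1 := Nat.find_spec hex'
        have h2 := Nat.find_min' hex' hi
        have h3 : Nat.find hex' ≠ 0 := by
          intro h0
          rw [h0] at h1
          simp [stage] at h1
        obtain ⟨l, hl⟩ := Nat.exists_eq_succ_of_ne_zero h3
        have h4 := Nat.find_min hex' (m := l) (by omega)
        rw [hl] at h1 h2
        refine ⟨⟨l, by omega⟩, Finset.mem_univ _, ?_⟩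
        simp only [I]
        rw [if_pos (by omega), Finset.mem_sdiff]
        exact ⟨h1, h4⟩
      · exact ⟨Fin.last r, Finset.mem_univ _, by simpa [I] using hi⟩
    · simp [I, Finset.card_compl, hA]
  refine ⟨r, hA ▸ hle r le_rfl, I, hI, (mem_blockBox_iff hI).2 fun l hl => ?_⟩
  ext i
  obtain ⟨j, hj⟩ := exists_mem_block hI i
  rw [mem_blocksUpto hI hj]
  rcases Nat.lt_or_ge r l with h | h
  · obtain rfl : l = r + 1 := by omega
    rw [← hrfix, hmem i j hj r le_rfl]
    omega
  · exact hmem i j hj l h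

variable {I : Fin (r + 1) → Finset (Fin N)}

theorem blockCell_zero_of_lt (hr : 0 < r) (i : Fin N) :
    blockCell S U I 0 i = hitBy (S i) (U i) 0 := by
  ext y
  constructor
  · intro h
    have := (h 0 (Nat.zero_le _)).2 ⟨le_rfl, hr⟩
    rwa [blocksUpto_zero] at this
  · intro h l _
    exact iff_of_true (hitBy_mono _ _ (Nat.zero_le _) h) ⟨Nat.zero_le _, hr⟩

theorem blockCell_succ_of_lt {j : ℕ} (hj : j + 1 < r) (i : Fin N) :
    blockCell S U I ⟨j + 1, by omega⟩ i =
      hitBy (S i) (U i) (blocksUpto I (j + 1)).card \ hitBy (S i) (U i) (blocksUpto I j).card := by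
  ext y
  constructor
  · intro h
    refine ⟨(h (j + 1) hj.le).2 ⟨le_rfl, hj⟩, fun h' => ?_⟩
    exact absurd ((h j (by omega)).1 h').1 (by simp)
  · rintro ⟨h1, h2⟩ l _
    have hm := fun {a b : ℕ} (hab : a ≤ b) =>
      hitBy_mono (S i) (U i) (Finset.card_le_card (monotone_blocksUpto I hab))
    by_cases hl : j + 1 ≤ l
    · exact iff_of_true (hm hl h1) ⟨hl, hj⟩
    · exact iff_of_false (fun h => h2 (hm (by omega) h)) fun h => hl h.1

theorem blockCell_last (i : Fin N) :
    blockCell S U I (Fin.last r) i = (hitBy (S i) (U i) (blocksUpto I r).card)ᶜ := by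
  ext y
  constructor
  · intro h h'
    exact absurd ((h r le_rfl).1 h').2 (by simp)
  · intro h l hl
    exact iff_of_false (fun h' => h (hitBy_mono (S i) (U i)
      (Finset.card_le_card (monotone_blocksUpto I hl)) h')) (by simp)

end Stages

/-! ### Measure of a box -/

section Measure

variable {N : ℕ} {X : Fin N → Type*} [∀ i, MeasurableSpace (X i)] {S : ∀ i, X i → X i}
  {U : ∀ i, Set (X i)} {r b : ℕ} {I : Fin (r + 1) → Finset (Fin N)}

theorem measurableSet_blockBox (hS : ∀ i, Measurable (S i)) (hU : ∀ i, MeasurableSet (U i)) :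
    MeasurableSet (blockBox S U I) := by
  refine MeasurableSet.univ_pi fun i => ?_
  simp only [blockCell, Set.ofPred_forall]
  refine MeasurableSet.iInter fun j => MeasurableSet.iInter fun _ => MeasurableSet.iInter fun l =>
    MeasurableSet.iInter fun _ => ?_
  exact (measurableSet_hitBy (hS i) (hU i) _).iff (MeasurableSet.const _)

variable {m : ∀ i, Measure (X i)} [∀ i, IsProbabilityMeasure (m i)]

theorem measureReal_blockBox (hI : IsBlocks r Finset.univ b I) :
    (Measure.pi m).real (blockBox S U I) =
      ∏ j, ∏ i ∈ I j, (m i).real (blockCell S U I j i) := by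
  have hprod : (Measure.pi m).real (blockBox S U I) =
      ∏ i, (m i).real {y | ∀ j, i ∈ I j → y ∈ blockCell S U I j i} := by
    simp only [blockBox, Measure.real, Measure.pi_pi, ENNReal.toReal_prod]
  rw [hprod, ← hI.2.2.1, Finset.prod_biUnion fun j _ j' _ h => hI.2.1 j j' h]
  refine Finset.prod_congr rfl fun j _ => Finset.prod_congr rfl fun i hi => ?_
  congr 1
  ext y
  refine ⟨fun h => h j hi, fun h j' hj' => ?_⟩
  rwa [hI.eq_of_mem hj' hi]

/-- Consecutive thresholds differ by the size of the preceding block, so the measures of the nested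
hitting sets differ by that size times the measure of `U i`. For the first block the threshold is
`0`, whence `k₀ = 1`. -/
theorem measureReal_blockBox_of_hitBy (hI : IsBlocks r Finset.univ b I)
    (hS : ∀ i, Measurable (S i)) (hU : ∀ i, MeasurableSet (U i))
    (hm : ∀ i, ∀ c ≤ N, (m i).real (hitBy (S i) (U i) c) = ((c : ℝ) + 1) * (m i).real (U i)) :
    (Measure.pi m).real (blockBox S U I) =
      (∏ l : Fin r, ∏ i ∈ I l.castSucc,
        (prevSize (fun j => (I j).card) l : ℝ) * (m i).real (U i)) *
          ∏ i ∈ I (Fin.last r), (1 - (((blocksUpto I r).card : ℝ) + 1) * (m i).real (U i)) := by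
  have hcard : ∀ l, (blocksUpto I l).card ≤ N := fun l => by
    simpa using Finset.card_le_univ (blocksUpto I l)
  rw [measureReal_blockBox hI, Fin.prod_univ_castSucc]
  congr 1
  · refine Finset.prod_congr rfl fun l _ => Finset.prod_congr rfl fun i _ => ?_
    obtain ⟨l, hl⟩ := l
    cases l with
    | zero =>
      have := blockCell_zero_of_lt (S := S) (U := U) (I := I) hl i
      change (m i).real (blockCell S U I 0 i) = _
      rw [this, hm i 0 (Nat.zero_le _)]
      simp [prevSize]
    | succ l =>
      change (m i).real (blockCell S U I ⟨l + 1, by omega⟩ i) = _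
      rw [blockCell_succ_of_lt hl, measureReal_sdiff (hitBy_mono _ _
        (Finset.card_le_card (monotone_blocksUpto I (Nat.le_succ l))))
        (measurableSet_hitBy (hS i) (hU i) _), hm i _ (hcard _), hm i _ (hcard _),
        card_blocksUpto_succ hI (by omega)]
      simp only [prevSize, Nat.add_eq_zero_iff, one_ne_zero, and_false, if_false,
        Nat.add_sub_cancel]
      push_cast
      ring
  · refine Finset.prod_congr rfl fun i _ => ?_
    rw [blockCell_last, probReal_compl_eq_one_sub (measurableSet_hitBy (hS i) (hU i) _),
      hm i _ (hcard _)]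

end Measure

/-! ### Rewriting and evaluating the sum over partitions -/

section Sums

variable {N : ℕ}

theorem sum_card_castSucc {r b : ℕ} {I : Fin (r + 1) → Finset (Fin N)}
    (hI : IsBlocks r Finset.univ b I) : ∑ l : Fin r, (I l.castSucc).card + b = N := by
  have h := Finset.card_biUnion fun j (_ : j ∈ Finset.univ) j' _ h => hI.2.1 j j' h
  rw [hI.2.2.1, Fin.sum_univ_castSucc, hI.2.2.2, Finset.card_univ, Fintype.card_fin] at h
  exact h.symm

-- A partition determines its block sizes, so the double sum is the sum over block splittings
-- grouped by size vector.
open Classical in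
theorem sum_avalancheSizes_orderedPartitions {M : Type*} [AddCommMonoid M] {a : ℕ} (ha : a ≤ N)
    (r : ℕ) (f : (Fin (r + 1) → ℕ) → (Fin (r + 1) → Finset (Fin N)) → M) :
    ∑ k ∈ avalancheSizes N r a, ∑ I ∈ orderedPartitions N r k, f k I =
      ∑ I with IsBlocks r Finset.univ (N - a) I, f (fun j => (I j).card) I := by
  have hcard : ∀ s : Finset (Fin N), s.card ≤ N := fun s => by simpa using s.card_le_univ
  rw [← Finset.sum_fiberwise_of_maps_to (t := avalancheSizes N r a)
    (g := fun (I : Fin (r + 1) → Finset (Fin N)) j => (I j).card)]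
  · refine Finset.sum_congr rfl fun k hk => ?_
    simp only [avalancheSizes, Finset.mem_filter, Fintype.mem_piFinset, Finset.mem_range] at hk
    obtain ⟨-, hk1, hk2, hk3⟩ := hk
    refine Finset.sum_congr ?_ fun I hI => ?_
    · ext I
      simp only [orderedPartitions, Finset.mem_filter, Finset.mem_univ, true_and]
      unfold IsBlocks
      constructor
      · rintro ⟨h1, h2, h3⟩
        refine ⟨⟨fun l => ?_, h2, h3, ?_⟩, funext h1⟩
        · rw [← Finset.card_pos, h1]
          exact hk1 l
        · rw [h1]
          omega
      · rintro ⟨⟨h1, h2, h3, h4⟩, h5⟩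
        exact ⟨congrFun h5, h2, h3⟩
    · simp only [Finset.mem_filter] at hI
      rw [hI.2]
  · intro I hI
    simp only [Finset.mem_filter, Finset.mem_univ, true_and] at hI
    simp only [avalancheSizes, Finset.mem_filter, Fintype.mem_piFinset, Finset.mem_range]
    refine ⟨fun l => Nat.lt_succ_of_le (hcard _), fun l => (hI.1 l).card_pos, ?_, ?_⟩
    · rw [hI.2.2.2]
      omega
    · have h := sum_card_castSucc hI
      omega

/-- The integer exponent makes `a = 0` meaningful: it gives `1 ^ (-1) = 1`. -/
theorem rootedForests_one (a : ℕ) :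
    (rootedForests 1 a : ℝ) = ((a : ℝ) + 1) ^ ((a : ℤ) - 1) := by
  cases a with
  | zero => simp [rootedForests]
  | succ a =>
    simp only [rootedForests]
    push_cast
    rw [add_sub_cancel_right, zpow_natCast, one_mul, add_comm]

theorem sum_orderedPartitions_const {a : ℕ} (ha : a ≤ N) (p q : ℝ) :
    ∑ r ∈ Finset.range (a + 1), ∑ k ∈ avalancheSizes N r a, ∑ I ∈ orderedPartitions N r k,
      (∏ l : Fin r, ∏ _i ∈ I l.castSucc, (prevSize k l : ℝ) * p) * ∏ _i ∈ I (Fin.last r), q =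
        ((a : ℝ) + 1) ^ ((a : ℤ) - 1) * (N.choose a : ℝ) * p ^ a * q ^ (N - a) := by
  classical
  have hr : ∀ r, ∑ k ∈ avalancheSizes N r a, ∑ I ∈ orderedPartitions N r k,
      (∏ l : Fin r, ∏ _i ∈ I l.castSucc, (prevSize k l : ℝ) * p) * ∏ _i ∈ I (Fin.last r), q =
        (blockWeight r 1 (Finset.univ : Finset (Fin N)) (N - a) : ℝ) * (p ^ a * q ^ (N - a)) := by
    intro r
    rw [sum_avalancheSizes_orderedPartitions ha r fun k I =>
      (∏ l : Fin r, ∏ _i ∈ I l.castSucc, (prevSize k l : ℝ) * p) * ∏ _i ∈ I (Fin.last r), q,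
      blockWeight, ← Finset.sum_filter, Nat.cast_sum, Finset.sum_mul]
    refine Finset.sum_congr rfl fun I hI => ?_
    simp only [Finset.mem_filter, Finset.mem_univ, true_and] at hI
    have hc := sum_card_castSucc hI
    simp only [Finset.prod_const, mul_pow, Finset.prod_mul_distrib, Finset.prod_pow_eq_pow_sum,
      hI.2.2.2, show ∑ l : Fin r, (I l.castSucc).card = a by omega, prevSizeFrom_one]
    push_cast
    ring
  rw [Finset.sum_congr rfl fun r _ => hr r, ← Finset.sum_mul, ← Nat.cast_sum,
    sum_blockWeight a (N - a) a 1 le_rfl _ (by simp; omega), Nat.add_sub_cancel' ha, Nat.cast_mul,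
    rootedForests_one]
  ring

end Sums

/-! ### Distribution of the avalanche size -/

section Size

variable {N : ℕ} {X : Fin N → Type*} {S : ∀ i, X i → X i} {U : ∀ i, Set (X i)}

open Classical in
theorem setOf_avalancheSize_eq {a : ℕ} (ha : a ≤ N) :
    {x | avalancheSize S U x = a} =
      ⋃ σ ∈ (Finset.range (a + 1)).sigma fun r => Finset.univ.filter
        fun I : Fin (r + 1) → Finset (Fin N) => IsBlocks r Finset.univ (N - a) I,
          blockBox S U σ.2 := by
  ext x
  simp only [Set.mem_iUnion, Finset.mem_sigma, Finset.mem_range, Finset.mem_filter,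
    Finset.mem_univ, true_and, exists_prop]
  constructor
  · rintro rfl
    obtain ⟨r, hr, I, hI, hx⟩ := exists_mem_blockBox (S := S) (U := U) x
    exact ⟨⟨r, I⟩, ⟨Nat.lt_succ_of_le hr, hI⟩, hx⟩
  · rintro ⟨⟨r, I⟩, ⟨-, hI⟩, hx⟩
    have := avalancheSize_add_of_mem_blockBox hI hx
    change avalancheSize S U x = a
    omega

variable [∀ i, MeasurableSpace (X i)]

theorem measurable_avalancheSize (hS : ∀ i, Measurable (S i)) (hU : ∀ i, MeasurableSet (U i)) :
    Measurable (avalancheSize S U) := by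
  refine measurable_to_countable' fun a => ?_
  change MeasurableSet {x | avalancheSize S U x = a}
  by_cases ha : a ≤ N
  · rw [setOf_avalancheSize_eq ha]
    exact Finset.measurableSet_biUnion _ fun _ _ => measurableSet_blockBox hS hU
  · convert! MeasurableSet.empty
    rw [Set.eq_empty_iff_forall_notMem]
    rintro x rfl
    exact ha (avalancheSize_le x)

theorem measureReal_avalancheSize_eq {m : ∀ i, Measure (X i)} [∀ i, IsProbabilityMeasure (m i)]
    (hS : ∀ i, Measurable (S i)) (hU : ∀ i, MeasurableSet (U i))
    (hm : ∀ i, ∀ c ≤ N, (m i).real (hitBy (S i) (U i) c) = ((c : ℝ) + 1) * (m i).real (U i))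
    {a : ℕ} (ha : a ≤ N) :
    (Measure.pi m).real {x | avalancheSize S U x = a} =
      ∑ r ∈ Finset.range (a + 1), ∑ k ∈ avalancheSizes N r a, ∑ I ∈ orderedPartitions N r k,
        (∏ l : Fin r, ∏ i ∈ I l.castSucc, (prevSize k l : ℝ) * (m i).real (U i)) *
          ∏ i ∈ I (Fin.last r), (1 - ((a : ℝ) + 1) * (m i).real (U i)) := by
  classical
  rw [setOf_avalancheSize_eq ha, measureReal_biUnion_finset, Finset.sum_sigma]
  · refine Finset.sum_congr rfl fun r _ => ?_
    rw [sum_avalancheSizes_orderedPartitions ha r fun k I =>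
      (∏ l : Fin r, ∏ i ∈ I l.castSucc, (prevSize k l : ℝ) * (m i).real (U i)) *
        ∏ i ∈ I (Fin.last r), (1 - ((a : ℝ) + 1) * (m i).real (U i))]
    refine Finset.sum_congr rfl fun I hI => ?_
    simp only [Finset.mem_filter, Finset.mem_univ, true_and] at hI
    have hc := card_blocksUpto_last hI
    rw [measureReal_blockBox_of_hitBy hI hS hU hm, show (blocksUpto I r).card = a by omega]
  -- A state determines first the number of blocks and then the blocks, so distinct boxes are
  -- disjoint.
  · rintro ⟨r, I⟩ hσ ⟨r', I'⟩ hσ' hne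
    simp only [Finset.coe_sigma, Set.mem_sigma_iff, Finset.mem_coe, Finset.mem_filter,
      Finset.mem_univ, true_and] at hσ hσ'
    refine Set.disjoint_left.2 fun x hx hx' => hne ?_
    obtain rfl := (le_of_mem_blockBox hσ.2 hσ'.2 hx hx').antisymm
      (le_of_mem_blockBox hσ'.2 hσ.2 hx' hx)
    rw [eq_of_mem_blockBox hσ.2 hσ'.2 hx hx']
  · exact fun _ _ => measurableSet_blockBox hS hU

end Size

theorem theorem3 (N : ℕ) (X : Fin N → Type*) [∀ i, MetricSpace (X i)]
    [∀ i, MeasurableSpace (X i)] [∀ i, BorelSpace (X i)]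
    (S : ∀ i, X i → X i) (hS : ∀ i, Continuous (S i))
    (m : ∀ i, Measure (X i)) [∀ i, IsProbabilityMeasure (m i)] (hm : ∀ i, Ergodic (S i) (m i))
    (U : ∀ i, Set (X i)) (hU : ∀ i, IsOpen (U i))
    (B : ∀ i, Set (X i)) (n : Fin N → ℕ) (hn : ∀ i, N < n i + 1)
    (htower : ∀ i, IsTower (S i) (m i) (B i) (n i) (U i)) :
    Measurable (avalancheSize S U) ∧
    (∀ a : ℕ, a ≤ N →
      (Measure.pi m).real {x | avalancheSize S U x = a} =
        ∑ r ∈ Finset.range (a + 1), ∑ k ∈ avalancheSizes N r a, ∑ I ∈ orderedPartitions N r k,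
          (∏ l : Fin r, ∏ i ∈ I l.castSucc, (prevSize k l : ℝ) * (m i).real (U i)) *
            ∏ i ∈ I (Fin.last r), (1 - ((a : ℝ) + 1) * (m i).real (U i))) ∧
    (∀ p : ℝ, (∀ i, (m i).real (U i) = p) → ∀ a : ℕ, a ≤ N →
      (Measure.pi m).real {x | avalancheSize S U x = a} =
        ((a : ℝ) + 1) ^ ((a : ℤ) - 1) * (N.choose a : ℝ) * p ^ a *
          (1 - ((a : ℝ) + 1) * p) ^ (N - a)) := by
  have hSm : ∀ i, Measurable (S i) := fun i => (hS i).measurable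
  have hUm : ∀ i, MeasurableSet (U i) := fun i => (hU i).measurableSet
  -- Thresholds are numbers of excited coordinates, hence at most `N`, and the tower height exceeds
  -- `N`.
  have hhit : ∀ i, ∀ c ≤ N,
      (m i).real (hitBy (S i) (U i) c) = ((c : ℝ) + 1) * (m i).real (U i) := fun i c hc =>
    (htower i).measureReal_hitBy (hm i).toMeasurePreserving (hUm i)
      (hc.trans (Nat.lt_succ_iff.1 (hn i)))
  refine ⟨measurable_avalancheSize hSm hUm,
    fun a ha => measureReal_avalancheSize_eq hSm hUm hhit ha, fun p hp a ha => ?_⟩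
  rw [measureReal_avalancheSize_eq hSm hUm hhit ha]
  simp only [hp]
  exact sum_orderedPartitions_const ha p _
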